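/- Let $b\ge 3$ and let $D\subset\{0,1,\dots,b-1\}$ with $2\le |D|<b$. Let $\mathcal C=\{\sum_{j=0}^{k} d_j b^j : k\ge 0,\ d_j\in D\}$ be the integer Cantor set with base $b$ and digit set $D$, listed in increasing order as $k_1<k_2<\cdots$, and let $s_b(k)$ be the sum of the base-$b$ digits of $k$. Let $s$ be the largest integer such that $D$ is contained in an arithmetic progression of step size $s$, and assume that $s\mid d$ for all $d\in D$. Write $e(\theta)=e^{2\pi i\theta}$. Let $U,V$ be commuting unitary operators on a complex Hilbert space $H$. Then for every $x\in H$ the limit $$L x=\lim_{N\to\infty}\frac1N\sum_{n=1}^{N}U^{k_n}V^{s_b(k_n)}x$$ exists in norm. It depends only on the point spectrum of $(U,V)$ at points of the set $\Lambda$ of all $(\alpha,\beta)\in(\mathbb R/\mathbb Z)^2$ such that, modulo $1$, $s\alpha=\frac{a}{b-1}+\frac{r}{b^t}$ and $s\beta=-\frac{a}{b-1}$ for some integers $a,r,t$, in the following sense. For $(\alpha,\beta)\in(\mathbb R/\mathbb Z)^2$ let $P_{\alpha,\beta}$ be the orthogonal projection onto the joint eigenspace $\{y\in H: Uy=e(\alpha)y,\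 Vy=e(\beta)y\}$, and let $P$ be the orthogonal projection onto the closed linear span of these joint eigenspaces over $(\alpha,\beta)\in\Lambda$. Then $Lx=L(Px)$ for all $x\in H$; moreover the limits $c(\alpha,\beta)=\lim_{N\to\infty}\frac1N\sum_{n=1}^{N}e(k_n\alpha+s_b(k_n)\beta)$ exist for all $(\alpha,\beta)\in(\mathbb R/\mathbb Z)^2$, and $Lx=\sum_{(\alpha,\beta)\in\Lambda}c(\alpha,\beta)\,P_{\alpha,\beta}x$ for all $x\in H$, with unconditional convergence in norm. -/

import Mathlib

open Filter Topology

noncomputable section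

/-- The integer Cantor set with base `b` and digit set `D`: all numbers
`∑_{j ≤ k} d_j b^j` with `k ∈ ℕ` and all `d_j ∈ D`. -/
def integerCantorSet (b : ℕ) (D : Finset ℕ) : Set ℕ :=
  {m | ∃ (k : ℕ) (d : ℕ → ℕ),
    (∀ j ≤ k, d j ∈ D) ∧ m = ∑ j ∈ Finset.range (k + 1), d j * b ^ j}

/-- The increasing enumeration of the Cantor set; `cantorSeq b D 0` is its smallest element. -/
def cantorSeq (b : ℕ) (D : Finset ℕ) (n : ℕ) : ℕ :=
  Nat.nth (fun m => m ∈ integerCantorSet b D) n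

/-- The sum of the base-`b` digits of `k`. -/
def digitSum (b k : ℕ) : ℕ := (Nat.digits b k).sum

/-- `D` is contained in an arithmetic progression of step size `q`. -/
def InProgression (D : Finset ℕ) (q : ℕ) : Prop :=
  ∃ c : ℕ, ∀ d ∈ D, ∃ j : ℕ, d = c + j * q

/-- The exponential sum average of `e(k α + s_b(k) β)`, `p = (α, β) ∈ (ℝ/ℤ)²`, over the `N`
smallest elements `k` of the Cantor set. -/
def cantorExpAverage (b : ℕ) (D : Finset ℕ) (p : UnitAddCircle × UnitAddCircle) (N : ℕ) : ℂ :=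
  (N : ℂ)⁻¹ * ∑ n ∈ Finset.range N,
    ((cantorSeq b D n • p.1 + digitSum b (cantorSeq b D n) • p.2).toCircle : ℂ)

/-- The points `(α, β) ∈ (ℝ/ℤ)²` with `s α = a/(b-1) + r/b^t` and `s β = -a/(b-1)` modulo `1`,
for some integers `a`, `r`, `t`. -/
def resonantPoints (b s : ℕ) : Set (UnitAddCircle × UnitAddCircle) :=
  {p | ∃ a r t : ℤ,
    s • p.1 = (((a : ℝ) / ((b : ℝ) - 1) + (r : ℝ) / (b : ℝ) ^ t : ℝ) : UnitAddCircle) ∧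
    s • p.2 = ((-((a : ℝ) / ((b : ℝ) - 1)) : ℝ) : UnitAddCircle)}

section Operators

variable {H : Type*} [NormedAddCommGroup H] [InnerProductSpace ℂ H]

/-- The average of `U^k V^(s_b(k)) x` over the `N` smallest elements `k` of the Cantor set. -/
def cantorAverage (b : ℕ) (D : Finset ℕ) (U V : H →L[ℂ] H) (N : ℕ) (x : H) : H :=
  (N : ℂ)⁻¹ • ∑ n ∈ Finset.range N,
    (U ^ cantorSeq b D n) ((V ^ digitSum b (cantorSeq b D n)) x)

/-- The joint eigenspace `{x | U x = e(α) x, V x = e(β) x}` at `p = (α, β) ∈ (ℝ/ℤ)²`. -/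
def jointEigenspace (U V : H →L[ℂ] H) (p : UnitAddCircle × UnitAddCircle) : Submodule ℂ H :=
  Module.End.eigenspace (U : H →ₗ[ℂ] H) (p.1.toCircle : ℂ) ⊓
    Module.End.eigenspace (V : H →ₗ[ℂ] H) (p.2.toCircle : ℂ)

theorem mem_jointEigenspace (U V : H →L[ℂ] H) (p : UnitAddCircle × UnitAddCircle) (x : H) :
    x ∈ jointEigenspace U V p ↔
      U x = (p.1.toCircle : ℂ) • x ∧ V x = (p.2.toCircle : ℂ) • x := by
  simp [jointEigenspace]

theorem isClosed_jointEigenspace (U V : H →L[ℂ] H) (p : UnitAddCircle × UnitAddCircle) :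
    IsClosed (jointEigenspace U V p : Set H) := by
  have h : (jointEigenspace U V p : Set H) =
      {x | U x = (p.1.toCircle : ℂ) • x} ∩ {x | V x = (p.2.toCircle : ℂ) • x} := by
    ext x
    exact mem_jointEigenspace U V p x
  rw [h]
  exact (isClosed_eq (by fun_prop) (by fun_prop)).inter
    (isClosed_eq (by fun_prop) (by fun_prop))

instance instCompleteJointEigenspace [CompleteSpace H] (U V : H →L[ℂ] H)
    (p : UnitAddCircle × UnitAddCircle) : CompleteSpace (jointEigenspace U V p) :=
  (isClosed_jointEigenspace U V p).completeSpace_coe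

/-- The closed linear span of the joint eigenspaces at the points of `Λ`. -/
def pointSpectralSubspace (U V : H →L[ℂ] H) (Λ : Set (UnitAddCircle × UnitAddCircle)) :
    Submodule ℂ H :=
  (⨆ p ∈ Λ, jointEigenspace U V p).topologicalClosure

instance instCompletePointSpectralSubspace [CompleteSpace H] (U V : H →L[ℂ] H)
    (Λ : Set (UnitAddCircle × UnitAddCircle)) :
    CompleteSpace (pointSpectralSubspace U V Λ) :=
  (Submodule.isClosed_topologicalClosure _).completeSpace_coe

end Operators

end

/-! The spectral theorem reduces norm convergence to pointwise convergence of exponential sums. The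
vector state of `z` on the commutative C⋆-algebra generated by `U` and `V` gives a finite measure μ
on the torus, and the squared norm of the average of `z` is the μ-integral of the squared modulus of
`cantorExpAverage`.

Splitting off the last digit turns the sum at p = (α, β) into `digitSetSum D p` times the sum at
(bα, β), up to a bounded error. Iterating, the mean at p is governed by the product of `digitMean`
along the orbit. A factor has modulus 1 only if s(α + β) = 0, by maximality of s, and compactness
makes this uniform. So if the phases θ_j = s(b^j α + β) do not tend to 0, infinitely many factors
stay below a fixed ρ < 1 and the mean is 0. If they do tend to 0, then (b-1)sβ = 0 and θ_{j+1} =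
bθ_j; expansion forces θ_j = 0 from some point on. Then p is resonant and, since s divides every
digit, the mean is a finite product.

The resonant set Λ is countable. A vector orthogonal to all joint eigenspaces over Λ has a spectral
measure without atoms in Λ (`spectral_measure_singleton_eq_zero`), so μ(Λ) = 0 and dominated
convergence sends its averages to 0. On the closed span of these eigenspaces the averages are
contractions that act diagonally, so the limit is taken term by term. -/

/-! ### Joint spectral measures via Gelfand duality and Riesz–Markov -/

open MeasureTheory WeakDual CompactlySupported in
/-- The vector state of a representation of a commutative C⋆-algebra is represented by a finite
measure on the character space. -/
theorem exists_measure_norm_sq_eq_integral {A : Type*} [CommCStarAlgebra A]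
    {H : Type*} [NormedAddCommGroup H] [InnerProductSpace ℂ H] [CompleteSpace H]
    [MeasurableSpace (characterSpace ℂ A)] [BorelSpace (characterSpace ℂ A)]
    (ρ : A →⋆ₐ[ℂ] (H →L[ℂ] H)) (z : H) :
    ∃ μ : Measure (characterSpace ℂ A), IsFiniteMeasure μ ∧
      ∀ a : A, ‖ρ a z‖ ^ 2 = ∫ φ, ‖φ a‖ ^ 2 ∂μ := by
  let G := gelfandStarTransform A
  have hstar : ∀ a : A, inner ℂ z (ρ (star a * a) z) = (‖ρ a z‖ : ℂ) ^ 2 := by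
    intro a
    rw [map_mul, map_star, mul_apply_eq_comp, ContinuousLinearMap.star_eq_adjoint,
      ContinuousLinearMap.adjoint_inner_right, inner_self_eq_norm_sq_to_K]
    rfl
  let toC : C_c(characterSpace ℂ A, ℝ) → C(characterSpace ℂ A, ℂ) := fun f =>
    ⟨fun φ => (f φ : ℂ), by fun_prop⟩
  let Λ₀ : C_c(characterSpace ℂ A, ℝ) →ₗ[ℝ] ℝ :=
    { toFun := fun f => (inner ℂ z (ρ (G.symm (toC f)) z)).re
      map_add' := by
        intro f g
        have : toC (f + g) = toC f + toC g := by ext φ; simp [toC]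
        simp [this]
      map_smul' := by
        intro c f
        have : toC (c • f) = (c : ℂ) • toC f := by ext φ; simp [toC]
        rw [this, map_smul, map_smul, smul_apply, inner_smul_right]
        simp }
  have hpos : ∀ f, 0 ≤ f → 0 ≤ Λ₀ f := by
    intro f hf
    -- Positivity: f is the square of the real function √f, so the functional takes the value ‖ρ(√f)
    -- z‖² at f.
    let g : C(characterSpace ℂ A, ℂ) := ⟨fun φ => (Real.sqrt (f φ) : ℂ), by fun_prop⟩
    have hg : toC f = star g * g := by
      ext φ
      have h0 : 0 ≤ f φ := hf φ
      simp only [toC, g, ContinuousMap.coe_mk, ContinuousMap.mul_apply, ContinuousMap.star_apply,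
        RCLike.star_def, Complex.conj_ofReal]
      rw [← Complex.ofReal_mul, Real.mul_self_sqrt h0]
    have : Λ₀ f = ‖ρ (G.symm g) z‖ ^ 2 := by
      change (inner ℂ z (ρ (G.symm (toC f)) z)).re = _
      rw [hg, map_mul, map_star, hstar]
      norm_cast
    rw [this]
    positivity
  let Λ : C_c(characterSpace ℂ A, ℝ) →ₚ[ℝ] ℝ := PositiveLinearMap.mk₀ Λ₀ hpos
  refine ⟨RealRMK.rieszMeasure Λ, inferInstance, fun a => ?_⟩
  let f : C_c(characterSpace ℂ A, ℝ) :=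
    CompactlySupportedContinuousMap.continuousMapEquiv ⟨fun φ => ‖G a φ‖ ^ 2, by fun_prop⟩
  have hf : toC f = star (G a) * G a := by
    ext φ
    change ((‖G a φ‖ ^ 2 : ℝ) : ℂ) = star (G a φ) * G a φ
    rw [RCLike.star_def, RCLike.conj_mul]
    norm_cast
  have h1 := RealRMK.integral_rieszMeasure Λ f
  have h2 : Λ f = ‖ρ a z‖ ^ 2 := by
    change (inner ℂ z (ρ (G.symm (toC f)) z)).re = _
    rw [hf, ← map_star, ← map_mul, StarAlgEquiv.symm_apply_apply, hstar]
    norm_cast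
  rw [← h2, ← h1]
  rfl

open MeasureTheory WeakDual in
/-- A joint spectral measure for a pair of commuting unitary operators and a vector. -/
theorem exists_joint_spectral_measure
    {H : Type*} [NormedAddCommGroup H] [InnerProductSpace ℂ H] [CompleteSpace H]
    {U V : H →L[ℂ] H} (hU : U ∈ unitary (H →L[ℂ] H)) (hV : V ∈ unitary (H →L[ℂ] H))
    (hUV : Commute U V) (z : H) :
    ∃ μ : Measure (UnitAddCircle × UnitAddCircle), IsFiniteMeasure μ ∧
      ∀ {ι : Type} (S : Finset ι) (a : ι → ℂ) (m n : ι → ℕ),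
        ‖∑ i ∈ S, a i • (U ^ m i) ((V ^ n i) z)‖ ^ 2 =
          ∫ p, ‖∑ i ∈ S, a i * ((m i • p.1 + n i • p.2).toCircle : ℂ)‖ ^ 2 ∂μ := by
  let T₀ : StarSubalgebra ℂ (H →L[ℂ] H) := StarAlgebra.adjoin ℂ {U, V}
  -- No Fuglede theorem is needed: `star V` is the inverse of V.
  have hUV' : Commute U (star V) := by
    have h1 : star V * V = 1 := hV.1
    have h2 : V * star V = 1 := hV.2
    change U * star V = star V * U
    calc U * star V = star V * (V * U) * star V := by rw [← mul_assoc, h1, one_mul]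
      _ = star V * U * (V * star V) := by rw [← hUV.eq]; simp only [mul_assoc]
      _ = star V * U := by rw [h2, mul_one]
  have hVU' : Commute V (star U) := by
    have := congrArg star hUV'.eq
    rwa [star_mul, star_mul, star_star] at this
  have hUU : Commute U (star U) := by rw [commute_iff_eq, hU.1, hU.2]
  have hVV : Commute V (star V) := by rw [commute_iff_eq, hV.1, hV.2]
  have hcomm₀ : IsMulCommutative T₀ := by
    refine StarAlgebra.isMulCommutative_adjoin ℂ ?_ ?_
    · rintro x (rfl | rfl) y (rfl | rfl)
      exacts [rfl, hUV.eq, hUV.eq.symm, rfl]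
    · rintro x (rfl | rfl) y (rfl | rfl)
      exacts [hUU.eq, hUV'.eq, hVU'.eq, hVV.eq]
  let T : StarSubalgebra ℂ (H →L[ℂ] H) := T₀.topologicalClosure
  have hTc : IsClosed (T : Set (H →L[ℂ] H)) := T₀.isClosed_topologicalClosure
  have hcomm : ∀ x y : T, x * y = y * x := by
    let := T₀.commRingTopologicalClosure fun x y => Subtype.ext (setLike_mul_comm x.2 y.2)
    intro x y
    exact mul_comm (G := T₀.topologicalClosure) x y
  have : CompleteSpace T := hTc.completeSpace_coe
  let : NormedCommRing T := { SubringClass.toNormedRing T with mul_comm := hcomm }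
  let : CommCStarAlgebra T := { }
  let : MeasurableSpace (characterSpace ℂ T) := borel _
  have : BorelSpace (characterSpace ℂ T) := ⟨rfl⟩
  obtain ⟨μ, hμ, hnorm⟩ := exists_measure_norm_sq_eq_integral T.subtype z
  have hT₀ : T₀ ≤ T := T₀.le_topologicalClosure
  let u : T := ⟨U, hT₀ (StarAlgebra.subset_adjoin ℂ _ (by simp))⟩
  let v : T := ⟨V, hT₀ (StarAlgebra.subset_adjoin ℂ _ (by simp))⟩
  have hcirc : ∀ (w : T), star w * w = 1 → ∀ φ : characterSpace ℂ T,
      φ w ∈ Submonoid.unitSphere ℂ := by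
    intro w hw φ
    have h1 : star (φ w) * φ w = 1 := by rw [← map_star, ← map_mul, hw, map_one]
    rw [RCLike.star_def, RCLike.conj_mul] at h1
    have h2 : ‖φ w‖ ^ 2 = 1 := Complex.ofReal_injective (by simpa using h1)
    have h3 : ‖φ w‖ = 1 := (pow_eq_one_iff_of_nonneg (norm_nonneg _) two_ne_zero).1 h2
    simpa [Submonoid.unitSphere] using h3
  have hu : ∀ φ : characterSpace ℂ T, φ u ∈ Submonoid.unitSphere ℂ :=
    hcirc u (Subtype.ext hU.1)
  have hv : ∀ φ : characterSpace ℂ T, φ v ∈ Submonoid.unitSphere ℂ :=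
    hcirc v (Subtype.ext hV.1)
  let F := AddCircle.homeomorphCircle (T := (1 : ℝ)) one_ne_zero
  -- A character takes unimodular values at u and v; their arguments map the character space to the
  -- torus, and the measure is pushed forward along this map.
  let π : characterSpace ℂ T → UnitAddCircle × UnitAddCircle := fun φ =>
    (F.symm ⟨φ u, hu φ⟩, F.symm ⟨φ v, hv φ⟩)
  have heval : ∀ w : T, Continuous fun φ : characterSpace ℂ T => φ w := fun w =>
    map_continuous (gelfandTransform ℂ T w)
  have hπ : Continuous π := by
    refine Continuous.prodMk (F.symm.continuous.comp ?_) (F.symm.continuous.comp ?_)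
    · exact (heval u).subtype_mk _
    · exact (heval v).subtype_mk _
  have hπ1 : ∀ φ, ((π φ).1.toCircle : ℂ) = φ u := fun φ => by
    rw [← AddCircle.homeomorphCircle_apply one_ne_zero]
    exact congrArg Subtype.val (F.apply_symm_apply _)
  have hπ2 : ∀ φ, ((π φ).2.toCircle : ℂ) = φ v := fun φ => by
    rw [← AddCircle.homeomorphCircle_apply one_ne_zero]
    exact congrArg Subtype.val (F.apply_symm_apply _)
  refine ⟨μ.map π, inferInstance, fun S a m n => ?_⟩
  have hc : Continuous fun p : UnitAddCircle × UnitAddCircle =>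
      ‖∑ i ∈ S, a i * ((m i • p.1 + n i • p.2).toCircle : ℂ)‖ ^ 2 := by
    have := AddCircle.continuous_toCircle (T := (1 : ℝ))
    fun_prop
  rw [integral_map hπ.aemeasurable hc.aestronglyMeasurable]
  have h1 := hnorm (∑ i ∈ S, a i • (u ^ m i * v ^ n i))
  have h2 : T.subtype (∑ i ∈ S, a i • (u ^ m i * v ^ n i)) z =
      ∑ i ∈ S, a i • (U ^ m i) ((V ^ n i) z) := by
    rw [map_sum, sum_apply]
    refine Finset.sum_congr rfl fun i _ => ?_
    rw [map_smul, map_mul, map_pow, map_pow]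
    rfl
  rw [h2] at h1
  rw [h1]
  refine integral_congr_ae (ae_of_all _ fun φ => ?_)
  simp only
  congr 2
  rw [map_sum]
  refine Finset.sum_congr rfl fun i _ => ?_
  rw [map_smul, map_mul, map_pow, map_pow, AddCircle.toCircle_add, AddCircle.toCircle_nsmul,
    AddCircle.toCircle_nsmul, smul_eq_mul]
  push_cast
  rw [hπ1, hπ2]

/-! ### Last-digit structure of the Cantor set -/

/-- The alternative q = 0 covers one-digit numbers: 0 belongs to the Cantor set only when 0 ∈ D. -/
theorem add_mem_integerCantorSet_iff {b : ℕ} {D : Finset ℕ} (hDb : ∀ d ∈ D, d < b)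
    {q d : ℕ} (hd : d < b) :
    b * q + d ∈ integerCantorSet b D ↔ d ∈ D ∧ (q = 0 ∨ q ∈ integerCantorSet b D) := by
  have hb : 0 < b := by omega
  constructor
  · rintro ⟨k, e, he, h⟩
    have h' : b * q + d = b * (∑ j ∈ Finset.range k, e (j + 1) * b ^ j) + e 0 := by
      rw [h, Finset.sum_range_succ', Finset.mul_sum]
      simp only [pow_succ, pow_zero, mul_one]
      congr 1
      exact Finset.sum_congr rfl fun j _ => by ring
    have he0 : e 0 < b := hDb _ (he 0 (Nat.zero_le _))
    have h1 : d = e 0 := by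
      have := congrArg (· % b) h'
      simpa [Nat.mul_add_mod, Nat.mod_eq_of_lt hd, Nat.mod_eq_of_lt he0] using this
    have h2 : q = ∑ j ∈ Finset.range k, e (j + 1) * b ^ j := by
      rw [h1] at h'
      exact Nat.eq_of_mul_eq_mul_left hb (Nat.add_right_cancel h')
    refine ⟨h1 ▸ he 0 (Nat.zero_le _), ?_⟩
    rcases k with - | k
    · left; simpa using h2
    · right; exact ⟨k, fun j => e (j + 1), fun j hj => he _ (by omega), h2⟩
  · rintro ⟨hdD, rfl | ⟨k, e, he, rfl⟩⟩
    · exact ⟨0, fun _ => d, fun _ _ => hdD, by simp⟩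
    · refine ⟨k + 1, fun j => Nat.casesOn j d e, ?_, ?_⟩
      · rintro (- | j) hj
        · exact hdD
        · exact he j (by omega)
      · rw [Finset.sum_range_succ' _ (k + 1), Finset.mul_sum]
        simp only [pow_succ, pow_zero, mul_one]
        congr 1
        exact Finset.sum_congr rfl fun j _ => by ring

theorem integerCantorSet_infinite {b : ℕ} {D : Finset ℕ} (hb : 0 < b) (hD : 2 ≤ D.card) :
    (integerCantorSet b D).Infinite := by
  obtain ⟨d, hd, hd0⟩ : ∃ d ∈ D, d ≠ 0 := by
    by_contra! h
    have : D ⊆ {0} := fun d hd => by simpa using h d hd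
    have := Finset.card_le_card this
    simp at this
    omega
  refine Set.infinite_of_forall_exists_gt fun n => ?_
  refine ⟨∑ j ∈ Finset.range (n + 1), d * b ^ j, ⟨n, fun _ => d, fun _ _ => hd, rfl⟩, ?_⟩
  calc n < ∑ j ∈ Finset.range (n + 1), 1 := by simp
    _ ≤ _ := Finset.sum_le_sum fun j _ => Nat.mul_pos (Nat.pos_of_ne_zero hd0) (Nat.pow_pos hb)

theorem digitSum_mul_add {b q d : ℕ} (hb : 2 ≤ b) (hd : d < b) :
    digitSum b (b * q + d) = d + digitSum b q := by
  unfold digitSum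
  by_cases h : d = 0 ∧ q = 0
  · simp [h]
  · rw [add_comm, Nat.digits_add b (by omega) d q hd (by tauto), List.sum_cons]

/-! ### Exponential sums and their digit recursion -/

noncomputable section

/-- The function `k ↦ e(k α + s_b(k) β)`. -/
def digitChar (b : ℕ) (p : UnitAddCircle × UnitAddCircle) (k : ℕ) : ℂ :=
  ((k • p.1 + digitSum b k • p.2).toCircle : ℂ)

/-- The sum of `e(k α + s_b(k) β)` over the elements `k < X` of the Cantor set. -/
def cantorExpSum (b : ℕ) (D : Finset ℕ) (p : UnitAddCircle × UnitAddCircle) (X : ℕ) : ℂ :=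
  ∑ k ∈ Finset.range X, (integerCantorSet b D).indicator (digitChar b p) k

open Classical in
/-- The number of elements of the Cantor set below `X`. -/
def cantorCount (b : ℕ) (D : Finset ℕ) (X : ℕ) : ℕ :=
  Nat.count (fun m => m ∈ integerCantorSet b D) X

/-- Multiplication by `b` of the first coordinate. -/
def baseShift (b : ℕ) (p : UnitAddCircle × UnitAddCircle) : UnitAddCircle × UnitAddCircle :=
  (b • p.1, p.2)

/-- The exponential sum over the digit set. -/
def digitSetSum (D : Finset ℕ) (p : UnitAddCircle × UnitAddCircle) : ℂ :=
  ∑ d ∈ D, ((d • (p.1 + p.2)).toCircle : ℂ)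

/-- The normalized exponential sum over the digit set. -/
def digitMean (D : Finset ℕ) (p : UnitAddCircle × UnitAddCircle) : ℂ :=
  (D.card : ℂ)⁻¹ * digitSetSum D p

end

theorem norm_digitChar (b : ℕ) (p : UnitAddCircle × UnitAddCircle) (k : ℕ) :
    ‖digitChar b p k‖ = 1 := Circle.norm_coe _

theorem digitChar_mul_add {b q d : ℕ} (hb : 2 ≤ b) (hd : d < b)
    (p : UnitAddCircle × UnitAddCircle) :
    digitChar b p (b * q + d) =
      ((d • (p.1 + p.2)).toCircle : ℂ) * digitChar b (baseShift b p) q := by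
  unfold digitChar baseShift
  rw [digitSum_mul_add hb hd, ← Circle.coe_mul, ← AddCircle.toCircle_add]
  congr 2
  simp only [add_smul, smul_add, mul_smul, smul_comm b q]
  abel

theorem digitChar_zero (b k : ℕ) : digitChar b 0 k = 1 := by simp [digitChar]

theorem cantorExpSum_zero (b : ℕ) (D : Finset ℕ) (X : ℕ) :
    cantorExpSum b D 0 X = cantorCount b D X := by
  classical
  unfold cantorExpSum cantorCount
  rw [Nat.count_eq_card_filter_range, Finset.card_filter]
  push_cast
  refine Finset.sum_congr rfl fun k _ => ?_
  simp [Set.indicator_apply, digitChar_zero]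

theorem Finset.sum_range_mul_eq {M : Type*} [AddCommMonoid M] (F : ℕ → M) (b Y : ℕ) :
    ∑ k ∈ Finset.range (b * Y), F k =
      ∑ q ∈ Finset.range Y, ∑ d ∈ Finset.range b, F (b * q + d) := by
  induction Y with
  | zero => simp
  | succ Y ih => rw [Nat.mul_succ, Finset.sum_range_add, ih, Finset.sum_range_succ]

/-- Group k < X by its quotient q by b. The blocks with q ≠ 0 factor exactly. One b in the bound
pays for q = 0, which may be missing from the Cantor set, the other for the incomplete last block.
-/
theorem norm_cantorExpSum_sub_le {b : ℕ} {D : Finset ℕ} (hb : 2 ≤ b) (hDb : ∀ d ∈ D, d < b)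
    (p : UnitAddCircle × UnitAddCircle) (X : ℕ) :
    ‖cantorExpSum b D p X - digitSetSum D p * cantorExpSum b D (baseShift b p) (X / b)‖
      ≤ 2 * b := by
  classical
  have hbound : ∀ k, ‖(integerCantorSet b D).indicator (digitChar b p) k‖ ≤ 1 := fun k =>
    (norm_indicator_le_norm_self _ _).trans (norm_digitChar b p k).le
  set Y := X / b with hY
  have hX : X = b * Y + X % b := (Nat.div_add_mod X b).symm
  have hterm : ∀ q, ‖∑ d ∈ Finset.range b,
      (integerCantorSet b D).indicator (digitChar b p) (b * q + d) -
      digitSetSum D p * (integerCantorSet b D).indicator (digitChar b (baseShift b p)) q‖ ≤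
      if q = 0 then (b : ℝ) else 0 := by
    intro q
    have hD : digitSetSum D p = ∑ d ∈ Finset.range b,
        if d ∈ D then ((d • (p.1 + p.2)).toCircle : ℂ) else 0 := by
      rw [← Finset.sum_filter]
      unfold digitSetSum
      congr 1
      ext d
      simp only [Finset.mem_filter, Finset.mem_range]
      exact ⟨fun h => ⟨hDb d h, h⟩, fun h => h.2⟩
    rw [hD, Finset.sum_mul, ← Finset.sum_sub_distrib]
    have hle : ∀ d ∈ Finset.range b,
        ‖(integerCantorSet b D).indicator (digitChar b p) (b * q + d) -
          (if d ∈ D then ((d • (p.1 + p.2)).toCircle : ℂ) else 0) *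
            (integerCantorSet b D).indicator (digitChar b (baseShift b p)) q‖ ≤
          if q = 0 then (1 : ℝ) else 0 := by
      intro d hd
      rw [Finset.mem_range] at hd
      simp only [Set.indicator_apply, add_mem_integerCantorSet_iff hDb hd,
        digitChar_mul_add hb hd]
      by_cases h1 : d ∈ D <;> by_cases h2 : q = 0 <;>
        by_cases h3 : q ∈ integerCantorSet b D <;>
          simp [h1, h2, h3, -smul_add]
      all_goals split_ifs <;> simp [norm_digitChar, Circle.norm_coe, -smul_add]
    refine (norm_sum_le_of_le _ hle).trans ?_
    split_ifs <;> simp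
  unfold cantorExpSum
  rw [hX, Finset.sum_range_add, Finset.sum_range_mul_eq, Finset.mul_sum, add_sub_right_comm,
    ← Finset.sum_sub_distrib]
  refine (norm_add_le _ _).trans ?_
  have h1 := norm_sum_le_of_le (Finset.range Y) fun q _ => hterm q
  have h2 := norm_sum_le_of_le (Finset.range (X % b)) fun d _ => hbound (b * Y + d)
  have h3 : ∑ q ∈ Finset.range Y, (if q = 0 then (b : ℝ) else 0) ≤ b := by
    rw [Finset.sum_ite_eq']
    split_ifs <;> simp
  have h4 : ∑ d ∈ Finset.range (X % b), (1 : ℝ) ≤ b := by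
    simp only [Finset.sum_const, Finset.card_range, nsmul_eq_mul, mul_one, Nat.cast_le]
    exact (Nat.mod_lt _ (by omega)).le
  linarith

/-- This is the digit recursion at p = 0, a fixed point of the shift. -/
theorem abs_cantorCount_sub_le {b : ℕ} {D : Finset ℕ} (hb : 2 ≤ b) (hDb : ∀ d ∈ D, d < b)
    (X : ℕ) : |(cantorCount b D X : ℝ) - D.card * cantorCount b D (X / b)| ≤ 2 * b := by
  have h := norm_cantorExpSum_sub_le hb hDb 0 X
  have h0 : baseShift b 0 = 0 := by simp [baseShift, Prod.ext_iff]
  have h1 : digitSetSum D 0 = D.card := by simp [digitSetSum]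
  rw [h0, h1, cantorExpSum_zero, cantorExpSum_zero] at h
  rw [← Real.norm_eq_abs, ← Complex.norm_real]
  push_cast
  exact h

theorem norm_digitSetSum_le (D : Finset ℕ) (p : UnitAddCircle × UnitAddCircle) :
    ‖digitSetSum D p‖ ≤ D.card := by
  refine (norm_sum_le_of_le D fun d _ => (Circle.norm_coe _).le).trans ?_
  simp

theorem norm_digitMean_le_one (D : Finset ℕ) (p : UnitAddCircle × UnitAddCircle) :
    ‖digitMean D p‖ ≤ 1 := by
  rw [digitMean, norm_mul, norm_inv, Complex.norm_natCast]
  exact inv_mul_le_one_of_le₀ (norm_digitSetSum_le D p) (Nat.cast_nonneg _)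

theorem tendsto_cantorCount {b : ℕ} {D : Finset ℕ} (hb : 0 < b) (hD : 2 ≤ D.card) :
    Tendsto (cantorCount b D) atTop atTop := by
  classical
  have hinf := integerCantorSet_infinite hb hD
  refine tendsto_atTop_atTop_of_monotone (Nat.count_monotone _) fun n => ?_
  refine ⟨Nat.nth (fun m => m ∈ integerCantorSet b D) n, ?_⟩
  unfold cantorCount
  rw [Nat.count_nth_of_infinite (p := fun m => m ∈ integerCantorSet b D) hinf]

/-- The partial sums at `p` stay, relative to the count, within `C` of `c` asymptotically. -/
def CantorMeanNear (b : ℕ) (D : Finset ℕ) (p : UnitAddCircle × UnitAddCircle) (c : ℂ) (C : ℝ) :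
    Prop :=
  ∀ ε > 0, ∀ᶠ X in atTop,
    ‖cantorExpSum b D p X - c * cantorCount b D X‖ ≤ (C + ε) * cantorCount b D X

/-- Dividing the recursion for sums by the one for counts multiplies both centre and radius by the
digit mean. The bounded errors vanish because the count tends to infinity. -/
theorem CantorMeanNear.of_baseShift {b : ℕ} {D : Finset ℕ} (hb : 2 ≤ b)
    (hDb : ∀ d ∈ D, d < b) (hD : 2 ≤ D.card) {p : UnitAddCircle × UnitAddCircle} {c : ℂ} {C : ℝ}
    (hC : 0 ≤ C) (h : CantorMeanNear b D (baseShift b p) c C) :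
    CantorMeanNear b D p (digitMean D p * c) (‖digitMean D p‖ * C) := by
  intro ε hε
  have hdiv : Tendsto (fun X : ℕ => X / b) atTop atTop :=
    Nat.tendsto_div_const_atTop (by omega)
  set g := digitMean D p with hg
  have hr : (D.card : ℂ) ≠ 0 := by exact_mod_cast (show D.card ≠ 0 by omega)
  have hG : digitSetSum D p = g * D.card := by rw [hg, digitMean]; field_simp
  -- Total bounded error: from the sum recursion, from bounding r m by n + 2b, and from exchanging
  -- the counts in the centre. Half of ε absorbs it once n is large.
  set K : ℝ := 2 * b + ‖g‖ * ((C + ε / 2) * (2 * b)) + ‖g * c‖ * (2 * b)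
  have hK : ∀ᶠ X in atTop, K / (ε / 2) ≤ (cantorCount b D X : ℝ) :=
    (tendsto_natCast_atTop_atTop.comp (tendsto_cantorCount (by omega) hD)).eventually_ge_atTop _
  filter_upwards [hdiv.eventually (h (ε / 2) (half_pos hε)), hK] with X hX hXK
  set Y := X / b
  have h1 := norm_cantorExpSum_sub_le hb hDb p X
  have h2 := abs_cantorCount_sub_le hb hDb X
  have h2' := abs_le.1 h2
  set n : ℝ := (cantorCount b D X : ℝ)
  set m : ℝ := (cantorCount b D Y : ℝ)
  set r : ℝ := (D.card : ℝ)
  have hrm : r * m ≤ n + 2 * b := by linarith [h2'.1]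
  have key : cantorExpSum b D p X - g * c * cantorCount b D X =
      (cantorExpSum b D p X - digitSetSum D p * cantorExpSum b D (baseShift b p) Y) +
      g * (D.card * (cantorExpSum b D (baseShift b p) Y - c * cantorCount b D Y)) -
      g * c * ((cantorCount b D X : ℂ) - D.card * cantorCount b D Y) := by
    rw [hG]; ring
  have h3 : ‖(cantorCount b D X : ℂ) - D.card * cantorCount b D Y‖ ≤ 2 * b := by
    rw [← Real.norm_eq_abs, ← Complex.norm_real] at h2
    simpa [n, m, r, Y] using h2
  have hg1 : ‖g‖ ≤ 1 := norm_digitMean_le_one D p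
  have h4 : ‖g * (D.card * (cantorExpSum b D (baseShift b p) Y - c * cantorCount b D Y))‖ ≤
      ‖g‖ * ((C + ε / 2) * (n + 2 * b)) := by
    rw [norm_mul, norm_mul, Complex.norm_natCast]
    refine mul_le_mul_of_nonneg_left ?_ (norm_nonneg _)
    calc r * _ ≤ r * ((C + ε / 2) * m) := mul_le_mul_of_nonneg_left hX (Nat.cast_nonneg _)
      _ = (C + ε / 2) * (r * m) := by ring
      _ ≤ _ := mul_le_mul_of_nonneg_left hrm (by positivity)
  have h5 : ‖g * c * ((cantorCount b D X : ℂ) - D.card * cantorCount b D Y)‖ ≤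
      ‖g * c‖ * (2 * b) := by
    rw [norm_mul]
    exact mul_le_mul_of_nonneg_left h3 (norm_nonneg _)
  have h6 : K ≤ ε / 2 * n := by
    rw [div_le_iff₀ (half_pos hε)] at hXK
    linarith
  have hn : 0 ≤ n := Nat.cast_nonneg _
  have h7 : ‖g‖ * (ε / 2 * n) ≤ ε / 2 * n :=
    mul_le_of_le_one_left (by positivity) hg1
  rw [key]
  refine (norm_sub_le _ _).trans ((add_le_add (norm_add_le _ _) le_rfl).trans ?_)
  have h8 : K = 2 * b + ‖g‖ * ((C + ε / 2) * (2 * b)) + ‖g * c‖ * (2 * b) := rfl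
  nlinarith [h1, h4, h5, h6, h7, h8]

theorem CantorMeanNear.of_iterate {b : ℕ} {D : Finset ℕ} (hb : 2 ≤ b)
    (hDb : ∀ d ∈ D, d < b) (hD : 2 ≤ D.card) {p : UnitAddCircle × UnitAddCircle} (t : ℕ)
    {c : ℂ} {C : ℝ} (hC : 0 ≤ C) (h : CantorMeanNear b D ((baseShift b)^[t] p) c C) :
    CantorMeanNear b D p ((∏ j ∈ Finset.range t, digitMean D ((baseShift b)^[j] p)) * c)
      (‖∏ j ∈ Finset.range t, digitMean D ((baseShift b)^[j] p)‖ * C) := by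
  induction t generalizing c C with
  | zero => simpa using h
  | succ t ih =>
    rw [Function.iterate_succ_apply'] at h
    have := ih (by positivity) (h.of_baseShift hb hDb hD hC)
    rw [Finset.prod_range_succ, norm_mul]
    simpa only [mul_assoc] using this

theorem cantorMeanNear_zero_one (b : ℕ) (D : Finset ℕ) (p : UnitAddCircle × UnitAddCircle) :
    CantorMeanNear b D p 0 1 := by
  classical
  intro ε hε
  filter_upwards with X
  have h : ‖cantorExpSum b D p X‖ ≤ cantorCount b D X := by
    unfold cantorExpSum cantorCount
    rw [Nat.count_eq_card_filter_range, Finset.card_filter]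
    push_cast
    refine norm_sum_le_of_le _ fun k _ => ?_
    rw [Set.indicator_apply]
    split_ifs <;> simp [norm_digitChar]
  have : (0 : ℝ) ≤ cantorCount b D X := Nat.cast_nonneg _
  simp only [zero_mul, sub_zero]
  nlinarith

/-- The enumeration starts at index 0, so exactly N elements lie strictly below `cantorSeq b D N`.
-/
theorem sum_range_cantorSeq {b : ℕ} {D : Finset ℕ} (hb : 0 < b) (hD : 2 ≤ D.card)
    (f : ℕ → ℂ) (N : ℕ) :
    ∑ n ∈ Finset.range N, f (cantorSeq b D n) =
      ∑ k ∈ Finset.range (cantorSeq b D N), (integerCantorSet b D).indicator f k := by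
  classical
  have hinf := integerCantorSet_infinite hb hD
  have hfil : ∀ N, ∑ k ∈ Finset.range (cantorSeq b D N), (integerCantorSet b D).indicator f k =
      ∑ k ∈ Finset.range (cantorSeq b D N) with k ∈ integerCantorSet b D, f k := by
    intro N
    rw [Finset.sum_filter]
    exact Finset.sum_congr rfl fun k _ => Set.indicator_apply _ _ _
  induction N with
  | zero =>
    rw [hfil]
    have : Nat.count (fun m => m ∈ integerCantorSet b D) (cantorSeq b D 0) = 0 :=
      Nat.count_nth_of_infinite (p := fun m => m ∈ integerCantorSet b D) hinf 0
    rw [Nat.count_eq_card_filter_range, Finset.card_eq_zero] at this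
    simp [this]
  | succ N ih =>
    have h := Nat.filter_range_nth_eq_insert_of_infinite
      (p := fun m => m ∈ integerCantorSet b D) hinf N
    rw [hfil] at ih ⊢
    unfold cantorSeq at ih ⊢
    rw [h, Finset.sum_insert (by simp), Finset.sum_range_succ, ih, add_comm]

theorem cantorExpAverage_eq {b : ℕ} {D : Finset ℕ} (hb : 0 < b) (hD : 2 ≤ D.card)
    (p : UnitAddCircle × UnitAddCircle) (N : ℕ) :
    cantorExpAverage b D p N = (N : ℂ)⁻¹ * cantorExpSum b D p (cantorSeq b D N) := by
  unfold cantorExpAverage cantorExpSum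
  rw [← sum_range_cantorSeq hb hD]
  rfl

theorem cantorCount_cantorSeq {b : ℕ} {D : Finset ℕ} (hb : 0 < b) (hD : 2 ≤ D.card) (N : ℕ) :
    cantorCount b D (cantorSeq b D N) = N := by
  classical
  exact Nat.count_nth_of_infinite (p := fun m => m ∈ integerCantorSet b D) 
    (integerCantorSet_infinite hb hD) N

theorem tendsto_cantorSeq {b : ℕ} {D : Finset ℕ} (hb : 0 < b) (hD : 2 ≤ D.card) :
    Tendsto (cantorSeq b D) atTop atTop :=
  (Nat.nth_strictMono (p := fun m => m ∈ integerCantorSet b D) 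
    (integerCantorSet_infinite hb hD)).tendsto_atTop

theorem CantorMeanNear.tendsto {b : ℕ} {D : Finset ℕ} (hb : 0 < b) (hD : 2 ≤ D.card)
    {p : UnitAddCircle × UnitAddCircle} {c : ℂ} (h : CantorMeanNear b D p c 0) :
    Tendsto (fun N => cantorExpAverage b D p N) atTop (𝓝 c) := by
  rw [tendsto_iff_norm_sub_tendsto_zero, Metric.tendsto_atTop']
  intro ε hε
  have h1 := (tendsto_cantorSeq hb hD).eventually (h (ε / 2) (half_pos hε))
  obtain ⟨N₀, hN₀⟩ := eventually_atTop.1 (h1.and (eventually_gt_atTop 0))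
  refine ⟨N₀, fun N hN => ?_⟩
  obtain ⟨h2, hpos⟩ := hN₀ N hN.le
  rw [cantorCount_cantorSeq hb hD, zero_add] at h2
  have hN0 : (N : ℂ) ≠ 0 := by exact_mod_cast hpos.ne'
  have hNr : (0 : ℝ) < N := by exact_mod_cast hpos
  rw [dist_zero_right, norm_norm, cantorExpAverage_eq hb hD]
  have : (N : ℂ)⁻¹ * cantorExpSum b D p (cantorSeq b D N) - c =
      (N : ℂ)⁻¹ * (cantorExpSum b D p (cantorSeq b D N) - c * N) := by
    field_simp
  rw [this, norm_mul, norm_inv, Complex.norm_natCast]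
  calc _ ≤ (N : ℝ)⁻¹ * (ε / 2 * N) := mul_le_mul_of_nonneg_left h2 (by positivity)
    _ = ε / 2 := by field_simp
    _ < ε := half_lt_self hε

/-! ### When the digit mean has modulus one -/

/-- Equality in the triangle inequality: the other terms contribute at most |D| - 2, so ‖z i + z j‖
= 2. -/
theorem eq_of_norm_sum_eq_card {ι : Type*} {D : Finset ι} {z : ι → ℂ} (hz : ∀ i ∈ D, ‖z i‖ = 1)
    (h : ‖∑ i ∈ D, z i‖ = D.card) {i j : ι} (hi : i ∈ D) (hj : j ∈ D) : z i = z j := by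
  classical
  by_cases hij : i = j
  · rw [hij]
  have hj' : j ∈ D.erase i := Finset.mem_erase.2 ⟨Ne.symm hij, hj⟩
  have h1 : ‖∑ k ∈ (D.erase i).erase j, z k‖ ≤ ((D.erase i).erase j).card := by
    refine (norm_sum_le_of_le _ fun k hk => (hz k ?_).le).trans (by simp)
    exact Finset.mem_of_mem_erase (Finset.mem_of_mem_erase hk)
  have hcard : (((D.erase i).erase j).card : ℝ) + 2 = D.card := by
    have e1 := Finset.card_erase_add_one hi
    have e2 := Finset.card_erase_add_one hj'
    rw [← e1, ← e2]
    push_cast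
    ring
  rw [← Finset.add_sum_erase D z hi, ← Finset.add_sum_erase _ z hj', ← add_assoc] at h
  have h2 := norm_add_le (z i + z j) (∑ k ∈ (D.erase i).erase j, z k)
  have h3 := norm_add_le (z i) (z j)
  have hi1 := hz i hi
  have hj1 := hz j hj
  have h4 : SameRay ℝ (z i) (z j) := sameRay_iff_norm_add.2 (by linarith)
  exact h4.eq_of_norm_eq (hi1.trans hj1.symm)

theorem inProgression_of_dvd_sub {D : Finset ℕ} (hD : D.Nonempty) {q : ℕ}
    (h : ∀ c ∈ D, ∀ d ∈ D, c ≤ d → q ∣ d - c) : InProgression D q := by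
  refine ⟨D.min' hD, fun d hd => ?_⟩
  have hle := D.min'_le d hd
  obtain ⟨j, hj⟩ := h _ (D.min'_mem hD) d hd hle
  exact ⟨j, by rw [mul_comm, ← hj]; omega⟩

theorem InProgression.dvd_sub {D : Finset ℕ} {q : ℕ} (h : InProgression D q) {c d : ℕ}
    (hc : c ∈ D) (hd : d ∈ D) : q ∣ d - c := by
  obtain ⟨a, ha⟩ := h
  obtain ⟨j, rfl⟩ := ha d hd
  obtain ⟨k, rfl⟩ := ha c hc
  exact ⟨j - k, by rw [Nat.add_sub_add_left, ← Nat.sub_mul, mul_comm]⟩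

/-- All dθ coincide, so the order of θ divides every difference of digits, and so does its lcm with
s. Maximality of s makes this lcm equal to s. -/
theorem nsmul_eq_zero_of_norm_digitMean_eq_one {D : Finset ℕ} (hD : 2 ≤ D.card) {s : ℕ}
    (hs : IsGreatest {q : ℕ | InProgression D q} s) {p : UnitAddCircle × UnitAddCircle}
    (h : ‖digitMean D p‖ = 1) : s • (p.1 + p.2) = 0 := by
  set θ := p.1 + p.2
  have hr : (D.card : ℝ) ≠ 0 := by exact_mod_cast (show D.card ≠ 0 by omega)
  rw [digitMean, norm_mul, norm_inv, Complex.norm_natCast, inv_mul_eq_iff_eq_mul₀ hr, mul_one] at h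
  have heq : ∀ c ∈ D, ∀ d ∈ D, c • θ = d • θ := fun c hc d hd =>
    AddCircle.injective_toCircle one_ne_zero (Circle.coe_injective
      (eq_of_norm_sum_eq_card (fun i _ => Circle.norm_coe _) h hc hd))
  have hl : ∀ c ∈ D, ∀ d ∈ D, c ≤ d → Nat.lcm (addOrderOf θ) s ∣ d - c := by
    intro c hc d hd hcd
    refine Nat.lcm_dvd (addOrderOf_dvd_of_nsmul_eq_zero ?_) (hs.1.dvd_sub hc hd)
    have := heq c hc d hd
    rw [← Nat.add_sub_cancel' hcd, add_smul] at this
    exact left_eq_add.1 this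
  have hle := hs.2 (inProgression_of_dvd_sub (Finset.card_pos.1 (by omega)) hl)
  obtain ⟨c, hc, d, hd, hcd⟩ := Finset.one_lt_card.1 hD
  -- `addOrderOf` is 0 at infinite order; two distinct digits exclude this.
  have hpos : 0 < Nat.lcm (addOrderOf θ) s := by
    rcases lt_or_gt_of_ne hcd with h1 | h1
    · exact Nat.pos_of_dvd_of_pos (hl c hc d hd h1.le) (by omega)
    · exact Nat.pos_of_dvd_of_pos (hl d hd c hc h1.le) (by omega)
  have hls : Nat.lcm (addOrderOf θ) s = s :=
    le_antisymm hle (Nat.le_of_dvd hpos (Nat.dvd_lcm_right _ _))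
  exact addOrderOf_dvd_iff_nsmul_eq_zero.1 (hls ▸ Nat.dvd_lcm_left _ _)

/-- The maximum over a compact subset of the torus is attained, hence is not 1. -/
theorem exists_norm_digitMean_le {D : Finset ℕ} (hD : 2 ≤ D.card) {s : ℕ}
    (hs : IsGreatest {q : ℕ | InProgression D q} s) {δ : ℝ} (hδ : 0 < δ) :
    ∃ ρ < 1, ∀ p : UnitAddCircle × UnitAddCircle,
      δ ≤ ‖s • (p.1 + p.2)‖ → ‖digitMean D p‖ ≤ ρ := by
  let K : Set (UnitAddCircle × UnitAddCircle) := {p | δ ≤ ‖s • (p.1 + p.2)‖}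
  have hK : IsCompact K := (isClosed_le continuous_const (by fun_prop)).isCompact
  have hc : Continuous fun p : UnitAddCircle × UnitAddCircle => ‖digitMean D p‖ := by
    unfold digitMean digitSetSum
    have := AddCircle.continuous_toCircle (T := (1 : ℝ))
    fun_prop
  rcases K.eq_empty_or_nonempty with h | h
  · refine ⟨0, one_pos, fun p hp => ?_⟩
    have : p ∈ K := hp
    simp [h] at this
  · obtain ⟨p₀, hp₀, hmax⟩ := hK.exists_isMaxOn h hc.continuousOn
    refine ⟨‖digitMean D p₀‖, lt_of_le_of_ne (norm_digitMean_le_one D p₀) fun h1 => ?_,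
      fun p hp => hmax hp⟩
    have := nsmul_eq_zero_of_norm_digitMean_eq_one hD hs h1
    have h2 : δ ≤ ‖s • (p₀.1 + p₀.2)‖ := hp₀
    rw [this, norm_zero] at h2
    linarith

/-! ### Expansion on the circle and resonance -/

theorem UnitAddCircle.exists_coe_abs_eq_norm (x : UnitAddCircle) :
    ∃ y : ℝ, (y : UnitAddCircle) = x ∧ |y| = ‖x‖ := by
  obtain ⟨y, rfl⟩ := QuotientAddGroup.mk_surjective x
  refine ⟨y - round y, ?_, (UnitAddCircle.norm_eq (x := y)).symm⟩
  have : ((round y : ℝ) : UnitAddCircle) = 0 := by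
    rw [AddCircle.coe_eq_zero_iff]
    exact ⟨round y, by simp⟩
  change ((y - round y : ℝ) : UnitAddCircle) = (y : UnitAddCircle)
  rw [AddCircle.coe_sub, this, sub_zero]

theorem UnitAddCircle.norm_nsmul_eq {b : ℕ} {x : UnitAddCircle} (h : b * ‖x‖ ≤ 1 / 2) :
    ‖b • x‖ = b * ‖x‖ := by
  obtain ⟨y, rfl, hy⟩ := exists_coe_abs_eq_norm x
  rw [← hy] at h ⊢
  rw [← AddCircle.coe_nsmul, nsmul_eq_mul, (AddCircle.norm_coe_eq_abs_iff 1 one_ne_zero).2]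
  · rw [abs_mul, Nat.abs_cast]
  · rw [abs_mul, Nat.abs_cast, abs_one]
    exact h

/-- Within 1/(2b) of 0, multiplication by b multiplies the norm by exactly b, so a nonzero orbit
cannot remain there. -/
theorem UnitAddCircle.eventually_eq_zero_of_expanding {b : ℕ} (hb : 2 ≤ b)
    {θ : ℕ → UnitAddCircle} (hθ : ∀ j, θ (j + 1) = b • θ j) (h : Tendsto θ atTop (𝓝 0)) :
    ∃ J, ∀ j ≥ J, θ j = 0 := by
  have hb0 : (0 : ℝ) < b := by exact_mod_cast (show 0 < b by omega)
  have hb2 : (2 : ℝ) ≤ b := by exact_mod_cast hb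
  have hn := h.norm
  rw [norm_zero] at hn
  obtain ⟨J, hJ⟩ := eventually_atTop.1 (hn.eventually_le_const (show 0 < 1 / (2 * (b : ℝ)) by positivity))
  have hgrow : ∀ i j, J ≤ j → ‖θ (j + i)‖ = b ^ i * ‖θ j‖ := by
    intro i j hj
    induction i with
    | zero => simp
    | succ i ih =>
      have h1 := hJ (j + i) (by omega)
      rw [← add_assoc, hθ, norm_nsmul_eq, ih, pow_succ]
      · ring
      · rw [le_div_iff₀ (by positivity)] at h1
        linarith
  refine ⟨J, fun j hj => ?_⟩
  by_contra hne
  have hpos : 0 < ‖θ j‖ := norm_pos_iff.2 hne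
  obtain ⟨i, hi⟩ := pow_unbounded_of_one_lt (1 / ‖θ j‖) (show (1 : ℝ) < b by linarith)
  have h1 := hJ (j + i) (by omega)
  rw [hgrow i j hj] at h1
  rw [div_lt_iff₀ hpos] at hi
  have : 1 / (2 * (b : ℝ)) ≤ 1 := by
    rw [div_le_one (by positivity)]
    linarith
  linarith

theorem baseShift_iterate (b : ℕ) (p : UnitAddCircle × UnitAddCircle) (j : ℕ) :
    (baseShift b)^[j] p = (b ^ j • p.1, p.2) := by
  induction j with
  | zero => simp
  | succ j ih =>
    rw [Function.iterate_succ_apply', ih, baseShift, smul_smul, pow_succ']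

/-- The orbit of `s (α + β)` under the base shift. -/
noncomputable def phaseOrbit (b s : ℕ) (p : UnitAddCircle × UnitAddCircle) (j : ℕ) :
    UnitAddCircle :=
  s • (((baseShift b)^[j] p).1 + ((baseShift b)^[j] p).2)

theorem phaseOrbit_eq (b s : ℕ) (p : UnitAddCircle × UnitAddCircle) (j : ℕ) :
    phaseOrbit b s p j = b ^ j • s • p.1 + s • p.2 := by
  rw [phaseOrbit, baseShift_iterate, smul_add, smul_comm]

theorem phaseOrbit_succ {b : ℕ} (hb : 1 ≤ b) (s : ℕ) (p : UnitAddCircle × UnitAddCircle)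
    (j : ℕ) : phaseOrbit b s p (j + 1) = b • phaseOrbit b s p j - (b - 1) • s • p.2 := by
  obtain ⟨c, rfl⟩ : ∃ c, b = c + 1 := ⟨b - 1, by omega⟩
  simp only [phaseOrbit_eq, Nat.add_sub_cancel]
  rw [pow_succ', mul_smul, smul_add, add_smul c 1 (s • p.2), one_smul]
  abel

/-- The limit of the affine recursion kills its constant term (b-1)sβ, which leaves multiplication
by b. -/
theorem eventually_phaseOrbit_eq_zero {b : ℕ} (hb : 2 ≤ b) {s : ℕ}
    {p : UnitAddCircle × UnitAddCircle} (h : Tendsto (phaseOrbit b s p) atTop (𝓝 0)) :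
    ∃ J, ∀ j ≥ J, phaseOrbit b s p j = 0 := by
  have h1 : (b - 1) • s • p.2 = 0 := by
    have h2 : Tendsto (fun j => b • phaseOrbit b s p j - phaseOrbit b s p (j + 1)) atTop
        (𝓝 (b • 0 - 0)) := (h.const_smul b).sub (h.comp (tendsto_add_atTop_nat 1))
    have h3 : (fun j => b • phaseOrbit b s p j - phaseOrbit b s p (j + 1)) =
        fun _ => (b - 1) • s • p.2 := by
      funext j
      rw [phaseOrbit_succ (by omega), sub_sub_cancel]
    rw [h3, smul_zero, sub_zero] at h2
    exact tendsto_nhds_unique tendsto_const_nhds h2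
  refine UnitAddCircle.eventually_eq_zero_of_expanding hb (fun j => ?_) h
  rw [phaseOrbit_succ (by omega), h1, sub_zero]

theorem mem_resonantPoints_of_phaseOrbit {b : ℕ} (hb : 2 ≤ b) {s : ℕ}
    {p : UnitAddCircle × UnitAddCircle} {J : ℕ} (h : ∀ j ≥ J, phaseOrbit b s p j = 0) :
    p ∈ resonantPoints b s := by
  have h1 : (b - 1) • s • p.2 = 0 := by
    have := phaseOrbit_succ (by omega) s p J (b := b)
    rw [h J le_rfl, h (J + 1) (by omega), smul_zero, zero_sub, zero_eq_neg] at this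
    exact this
  have h2 := h J le_rfl
  rw [phaseOrbit_eq] at h2
  obtain ⟨x, hx⟩ := QuotientAddGroup.mk_surjective (s • p.2)
  obtain ⟨y, hy⟩ := QuotientAddGroup.mk_surjective (s • p.1)
  have hx' : s • p.2 = (x : UnitAddCircle) := hx.symm
  have hy' : s • p.1 = (y : UnitAddCircle) := hy.symm
  rw [hx', ← AddCircle.coe_nsmul, AddCircle.coe_eq_zero_iff] at h1
  rw [hx', hy', ← AddCircle.coe_nsmul, ← AddCircle.coe_add, AddCircle.coe_eq_zero_iff] at h2
  obtain ⟨m, hm⟩ := h1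
  obtain ⟨n, hn⟩ := h2
  simp only [zsmul_eq_mul, mul_one, nsmul_eq_mul, Nat.cast_pow] at hm hn
  rw [Nat.cast_sub (by omega), Nat.cast_one] at hm
  have hb2 : (2 : ℝ) ≤ b := by exact_mod_cast hb
  have hb1 : (b : ℝ) - 1 ≠ 0 := by linarith
  have hb0 : (b : ℝ) ≠ 0 := by linarith
  obtain ⟨e, he⟩ : ((b : ℤ) - 1) ∣ (b : ℤ) ^ J - 1 := sub_one_dvd_pow_sub_one _ _
  have he' : (b : ℝ) ^ J - 1 = (b - 1) * e := by exact_mod_cast he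
  -- With x, y lifting sβ, sα: (b-1)x = m and b^J y + x = n. Solving y = -m/(b-1) + r/b^J gives r =
  -- n + m(b^J - 1)/(b-1).
  refine ⟨-m, n + m * e, J, ?_, ?_⟩
  · rw [hy']
    congr 1
    rw [zpow_natCast]
    push_cast
    field_simp
    have : (b : ℝ) ^ J = (b - 1) * e + 1 := by linarith
    linear_combination (-(b : ℝ) + 1) * hn + hm + m * this
  · rw [hx']
    congr 1
    push_cast
    field_simp
    linear_combination -hm

/-- Each digit is a multiple of s and contributes a multiple of a vanishing phase. The case k = 0 is
where stripping digits ends. -/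
theorem digitChar_eq_one {b : ℕ} (hb : 2 ≤ b) {D : Finset ℕ} (hDb : ∀ d ∈ D, d < b) {s : ℕ}
    (hsD : ∀ d ∈ D, s ∣ d) {k : ℕ} (hk : k = 0 ∨ k ∈ integerCantorSet b D)
    {p : UnitAddCircle × UnitAddCircle} (h : ∀ j, phaseOrbit b s p j = 0) :
    digitChar b p k = 1 := by
  induction k using Nat.strong_induction_on generalizing p with
  | _ k ih =>
    rcases Nat.eq_zero_or_pos k with rfl | hpos
    · simp [digitChar, digitSum]
    have hmod : k % b < b := Nat.mod_lt _ (by omega)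
    have hk' : b * (k / b) + k % b ∈ integerCantorSet b D := by
      rw [Nat.div_add_mod]
      exact hk.resolve_left hpos.ne'
    rw [add_mem_integerCantorSet_iff hDb hmod] at hk'
    have h0 := h 0
    obtain ⟨e, he⟩ := hsD _ hk'.1
    rw [← Nat.div_add_mod k b, digitChar_mul_add hb hmod,
      ih (k / b) (Nat.div_lt_self hpos (by omega)) hk'.2 fun j => h (j + 1), he, mul_comm s e,
      mul_smul, show s • (p.1 + p.2) = 0 from h0]
    simp

theorem cantorMeanNear_one_zero {b : ℕ} (hb : 2 ≤ b) {D : Finset ℕ} (hDb : ∀ d ∈ D, d < b)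
    {s : ℕ} (hsD : ∀ d ∈ D, s ∣ d) {p : UnitAddCircle × UnitAddCircle}
    (h : ∀ j, phaseOrbit b s p j = 0) : CantorMeanNear b D p 1 0 := by
  have : ∀ X, cantorExpSum b D p X = cantorCount b D X := by
    intro X
    rw [← cantorExpSum_zero]
    unfold cantorExpSum
    refine Finset.sum_congr rfl fun k _ => ?_
    by_cases hk : k ∈ integerCantorSet b D
    · rw [Set.indicator_of_mem hk, Set.indicator_of_mem hk, digitChar_zero,
        digitChar_eq_one hb hDb hsD (Or.inr hk) h]
    · rw [Set.indicator_of_notMem hk, Set.indicator_of_notMem hk]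
  intro ε hε
  filter_upwards with X
  rw [this, one_mul, sub_self, norm_zero]
  positivity

/-! ### Limits of the exponential averages -/

/-- The norms decrease to some l ≥ 0, and infinitely many steps contract by a fixed ρ < 1, so l ≤ ρ
l. -/
theorem tendsto_norm_prod_digitMean {b : ℕ} {D : Finset ℕ} (hD : 2 ≤ D.card) {s : ℕ}
    (hs : IsGreatest {q : ℕ | InProgression D q} s) {p : UnitAddCircle × UnitAddCircle}
    (h : ¬ Tendsto (phaseOrbit b s p) atTop (𝓝 0)) :
    Tendsto (fun t => ‖∏ j ∈ Finset.range t, digitMean D ((baseShift b)^[j] p)‖) atTop (𝓝 0) := by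
  set a : ℕ → ℝ := fun t => ‖∏ j ∈ Finset.range t, digitMean D ((baseShift b)^[j] p)‖
  have hsucc : ∀ t, a (t + 1) = a t * ‖digitMean D ((baseShift b)^[t] p)‖ := fun t => by
    simp only [a, Finset.prod_range_succ, norm_mul]
  have ha0 : ∀ t, 0 ≤ a t := fun t => norm_nonneg _
  have hanti : Antitone a := antitone_nat_of_succ_le fun t => by
    rw [hsucc]
    exact mul_le_of_le_one_right (ha0 t) (norm_digitMean_le_one _ _)
  have hlim := tendsto_atTop_ciInf hanti ⟨0, by rintro _ ⟨t, rfl⟩; exact ha0 t⟩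
  set l := ⨅ t, a t
  have hl0 : 0 ≤ l := ge_of_tendsto' hlim ha0
  rw [tendsto_zero_iff_norm_tendsto_zero, Metric.tendsto_atTop'] at h
  push Not at h
  obtain ⟨δ, hδ, hfreq⟩ := h
  obtain ⟨ρ, hρ, hle⟩ := exists_norm_digitMean_le hD hs hδ
  have hf : ∃ᶠ t in atTop, a (t + 1) - ρ * a t ≤ 0 := by
    rw [frequently_atTop]
    intro N
    obtain ⟨t, ht, h1⟩ := hfreq N
    rw [dist_zero_right, norm_norm] at h1
    refine ⟨t, ht.le, ?_⟩
    rw [hsucc, mul_comm ρ]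
    have := mul_le_mul_of_nonneg_left (hle _ h1) (ha0 t)
    linarith
  have h2 : l - ρ * l ≤ 0 :=
    le_of_tendsto_of_frequently ((hlim.comp (tendsto_add_atTop_nat 1)).sub (hlim.const_mul ρ)) hf
  have : l = 0 := by nlinarith
  rwa [this] at hlim

/-- The exponential averages over the Cantor set converge, and the limit vanishes off the
resonant points. -/
theorem exists_tendsto_cantorExpAverage {b : ℕ} (hb : 2 ≤ b) {D : Finset ℕ}
    (hDb : ∀ d ∈ D, d < b) (hD : 2 ≤ D.card) {s : ℕ}
    (hs : IsGreatest {q : ℕ | InProgression D q} s) (hsD : ∀ d ∈ D, s ∣ d)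
    (p : UnitAddCircle × UnitAddCircle) :
    ∃ c : ℂ, Tendsto (fun N => cantorExpAverage b D p N) atTop (𝓝 c) ∧
      (p ∉ resonantPoints b s → c = 0) := by
  by_cases h : Tendsto (phaseOrbit b s p) atTop (𝓝 0)
  · obtain ⟨J, hJ⟩ := eventually_phaseOrbit_eq_zero hb h
    have h1 : ∀ j, phaseOrbit b s ((baseShift b)^[J] p) j = 0 := by
      intro j
      rw [phaseOrbit, ← Function.iterate_add_apply]
      exact hJ _ (by omega)
    have h2 := (cantorMeanNear_one_zero hb hDb hsD h1).of_iterate hb hDb hD J le_rfl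
    rw [mul_zero] at h2
    exact ⟨_, h2.tendsto (by omega) hD,
      fun hp => absurd (mem_resonantPoints_of_phaseOrbit hb hJ) hp⟩
  · refine ⟨0, CantorMeanNear.tendsto (by omega) hD fun ε hε => ?_, fun _ => rfl⟩
    obtain ⟨t, ht⟩ := ((tendsto_norm_prod_digitMean hD hs h).eventually_lt_const
      (half_pos hε)).exists
    -- The trivial bound after t shifts: centre 0, and the product as radius.
    have h1 := (cantorMeanNear_zero_one b D ((baseShift b)^[t] p)).of_iterate hb hDb hD t
      zero_le_one
    rw [mul_zero, mul_one] at h1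
    filter_upwards [h1 (ε / 2) (half_pos hε)] with X hX
    refine hX.trans (mul_le_mul_of_nonneg_right ?_ (Nat.cast_nonneg _))
    linarith

theorem countable_resonantPoints (b : ℕ) {s : ℕ} (hs : 0 < s) :
    (resonantPoints b s).Countable := by
  have hfib : ∀ (x : UnitAddCircle) (v : ℝ), s • x = (v : UnitAddCircle) →
      ∃ m : ℤ, x = (((v + m) / s : ℝ) : UnitAddCircle) := by
    intro x v h
    obtain ⟨y, rfl⟩ := QuotientAddGroup.mk_surjective x
    change s • (y : UnitAddCircle) = _ at h
    rw [← AddCircle.coe_nsmul, ← sub_eq_zero, ← AddCircle.coe_sub,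
      AddCircle.coe_eq_zero_iff] at h
    obtain ⟨m, hm⟩ := h
    simp only [zsmul_eq_mul, mul_one, nsmul_eq_mul] at hm
    refine ⟨m, ?_⟩
    change (y : UnitAddCircle) = _
    congr 1
    have : (s : ℝ) ≠ 0 := by exact_mod_cast hs.ne'
    field_simp
    linarith
  -- The last two integers select the s-division points of the two coordinates.
  let f : ℤ × ℤ × ℤ × ℤ × ℤ → UnitAddCircle × UnitAddCircle := fun q =>
    (((((q.1 : ℝ) / ((b : ℝ) - 1) + (q.2.1 : ℝ) / (b : ℝ) ^ q.2.2.1) + q.2.2.2.1) / s : ℝ),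
      ((-((q.1 : ℝ) / ((b : ℝ) - 1)) + q.2.2.2.2) / s : ℝ))
  refine (Set.countable_range f).mono ?_
  rintro p ⟨a, r, t, h1, h2⟩
  obtain ⟨m, hm⟩ := hfib _ _ h1
  obtain ⟨n, hn⟩ := hfib _ _ h2
  exact ⟨(a, r, t, m, n), Prod.ext hm.symm hn.symm⟩

/-! ### Mean ergodic theorem and joint eigenspaces -/

section

variable {H : Type*} [NormedAddCommGroup H] [InnerProductSpace ℂ H] [CompleteSpace H]

theorem norm_pow_apply_of_mem_unitary {U : H →L[ℂ] H} (hU : U ∈ unitary (H →L[ℂ] H)) (n : ℕ)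
    (x : H) : ‖(U ^ n) x‖ = ‖x‖ :=
  ContinuousLinearMap.norm_map_of_mem_unitary (pow_mem hU n) x

/-- The averages of a unitary operator twisted by a character. -/
noncomputable def twistedAverage (U : H →L[ℂ] H) (θ : UnitAddCircle) (N : ℕ) : H →L[ℂ] H :=
  (N : ℂ)⁻¹ • ∑ n ∈ Finset.range N, ((n • -θ).toCircle : ℂ) • U ^ n

/-- Von Neumann's theorem for the contraction e(-θ)U, whose fixed vectors are the eigenvectors of U
at e(θ); R is the orthogonal projection onto them. -/
theorem exists_twistedAverage_limit {U : H →L[ℂ] H} (hU : U ∈ unitary (H →L[ℂ] H))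
    (θ : UnitAddCircle) :
    ∃ R : H →L[ℂ] H, (∀ z, Tendsto (fun N => twistedAverage U θ N z) atTop (𝓝 (R z))) ∧
      (∀ z, U (R z) = (θ.toCircle : ℂ) • R z) ∧
      ∀ y z, U y = (θ.toCircle : ℂ) • y → inner ℂ y (R z) = inner ℂ y z := by
  let f : H →L[ℂ] H := ((-θ).toCircle : ℂ) • U
  have hcancel : (θ.toCircle : ℂ) * ((-θ).toCircle : ℂ) = 1 := by
    rw [← Circle.coe_mul, ← AddCircle.toCircle_add, add_neg_cancel, AddCircle.toCircle_zero,
      Circle.coe_one]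
  have hf : ‖f‖ ≤ 1 := by
    refine ContinuousLinearMap.opNorm_le_bound _ zero_le_one fun x => ?_
    simp only [f, smul_apply, norm_smul, Circle.norm_coe, one_mul]
    exact (ContinuousLinearMap.norm_map_of_mem_unitary hU x).le
  let E := f.eqLocus (1 : H →L[ℂ] H)
  have hE : ∀ y, y ∈ E ↔ U y = (θ.toCircle : ℂ) • y := by
    intro y
    change ((-θ).toCircle : ℂ) • U y = y ↔ _
    constructor
    · intro h
      rw [← h, smul_smul, hcancel, one_smul, h]
    · intro h
      rw [h, smul_smul, mul_comm, hcancel, one_smul]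
  have hcomplete : CompleteSpace E := by
    refine IsClosed.completeSpace_coe (hs := ?_)
    exact isClosed_eq f.continuous (1 : H →L[ℂ] H).continuous
  refine ⟨E.starProjection, fun z => ?_, fun z => ?_, fun y z hy => ?_⟩
  · refine (f.tendsto_birkhoffAverage_orthogonalProjection hf z).congr fun N => ?_
    rw [birkhoffAverage, birkhoffSum, twistedAverage, smul_apply, sum_apply]
    congr 1
    refine Finset.sum_congr rfl fun n _ => ?_
    have : f^[n] z = (f ^ n) z := by rw [FunLike.coe_pow_eq_iterate]
    rw [id, this]
    simp only [f, smul_pow, AddCircle.toCircle_nsmul, Circle.coe_pow]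
  · exact (hE _).1 (E.starProjection_apply_mem z)
  · rw [← Submodule.inner_starProjection_left_eq_right,
      Submodule.starProjection_eq_self_iff.2 ((hE y).2 hy)]

end

section

variable {H : Type*} [NormedAddCommGroup H] [InnerProductSpace ℂ H]

theorem commute_twistedAverage {U V : H →L[ℂ] H} (hUV : Commute U V) (θ : UnitAddCircle)
    (N : ℕ) : Commute (twistedAverage U θ N) V :=
  (Commute.sum_left _ _ _ fun n _ => ((hUV.pow_left n).smul_left _)).smul_left _

theorem inner_eq_zero_of_eigenvalue_ne [CompleteSpace H] {U : H →L[ℂ] H} (hU : U ∈ unitary (H →L[ℂ] H))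
    {θ η : UnitAddCircle} (h : θ ≠ η) {y w : H} (hy : U y = (θ.toCircle : ℂ) • y)
    (hw : U w = (η.toCircle : ℂ) • w) : inner ℂ y w = 0 := by
  have h1 := ContinuousLinearMap.inner_map_map_of_mem_unitary hU y w
  rw [hy, hw, inner_smul_left, inner_smul_right, ← mul_assoc, ← Circle.coe_inv_eq_conj,
    ← Circle.coe_mul] at h1
  by_contra hne
  have h2 : (((θ.toCircle)⁻¹ * η.toCircle : Circle) : ℂ) = 1 := by
    have : ((((θ.toCircle)⁻¹ * η.toCircle : Circle) : ℂ) - 1) * inner ℂ y w = 0 := by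
      rw [sub_mul, h1, one_mul, sub_self]
    exact sub_eq_zero.1 ((mul_eq_zero.1 this).resolve_right hne)
  have h3 : (θ.toCircle)⁻¹ * η.toCircle = 1 := Circle.coe_injective (by rw [h2, Circle.coe_one])
  exact h (AddCircle.injective_toCircle one_ne_zero (inv_mul_eq_one.1 h3))

theorem orthogonalFamily_jointEigenspace [CompleteSpace H] {U V : H →L[ℂ] H} (hU : U ∈ unitary (H →L[ℂ] H))
    (hV : V ∈ unitary (H →L[ℂ] H)) :
    OrthogonalFamily ℂ (fun p => jointEigenspace U V p)
      fun p => (jointEigenspace U V p).subtypeₗᵢ := by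
  intro p q hpq y w
  obtain ⟨hy1, hy2⟩ := (mem_jointEigenspace U V p _).1 y.2
  obtain ⟨hw1, hw2⟩ := (mem_jointEigenspace U V q _).1 w.2
  by_cases h : p.1 = q.1
  · exact inner_eq_zero_of_eigenvalue_ne hV (fun h' => hpq (Prod.ext h h')) hy2 hw2
  · exact inner_eq_zero_of_eigenvalue_ne hU h hy1 hw1

/-! ### Orthogonal sums of subspaces -/

section HilbertSum

variable {ι : Type*} {E : ι → Submodule ℂ H} [∀ i, CompleteSpace (E i)]

/-- Bessel's inequality: a partial sum w satisfies ⟨w, x⟩ = ‖w‖², so ‖w‖ ≤ ‖x‖. -/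
theorem OrthogonalFamily.summable_norm_sq_starProjection
    (hE : OrthogonalFamily ℂ (fun i => E i) fun i => (E i).subtypeₗᵢ) (x : H) :
    Summable fun i => ‖(E i).starProjection x‖ ^ 2 := by
  refine summable_of_sum_le (c := ‖x‖ ^ 2) (fun i => by positivity) fun S => ?_
  set w := ∑ i ∈ S, (E i).starProjection x with hw
  have h1 : ‖w‖ ^ 2 = ∑ i ∈ S, ‖(E i).starProjection x‖ ^ 2 :=
    hE.norm_sum (fun i => ⟨(E i).starProjection x, (E i).starProjection_apply_mem x⟩) S
  have h2 : (inner ℂ w x : ℂ) = ((∑ i ∈ S, ‖(E i).starProjection x‖ ^ 2 : ℝ) : ℂ) := by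
    rw [hw, sum_inner]
    push_cast
    refine Finset.sum_congr rfl fun i _ => ?_
    have h3 : (E i).starProjection x =
        (E i).starProjection ((E i).starProjection x) :=
      (Submodule.starProjection_eq_self_iff.2 ((E i).starProjection_apply_mem x)).symm
    rw [h3, Submodule.inner_starProjection_left_eq_right, ← h3, inner_self_eq_norm_sq_to_K]
    rfl
  have h4 : ‖w‖ ^ 2 ≤ ‖w‖ * ‖x‖ := by
    have := norm_inner_le_norm (𝕜 := ℂ) w x
    rw [h2, ← h1, Complex.norm_real, Real.norm_eq_abs, abs_of_nonneg (by positivity)] at this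
    exact this
  rw [← h1]
  have h5 : ‖w‖ ≤ ‖x‖ := by
    by_contra! h
    have := norm_nonneg x
    nlinarith
  gcongr

theorem OrthogonalFamily.summable_smul_starProjection [CompleteSpace H]
    (hE : OrthogonalFamily ℂ (fun i => E i) fun i => (E i).subtypeₗᵢ) {c : ι → ℂ}
    (hc : ∀ i, ‖c i‖ ≤ 1) (x : H) : Summable fun i => c i • (E i).starProjection x := by
  have h := (hE.summable_iff_norm_sq_summable fun i =>
    c i • ⟨(E i).starProjection x, (E i).starProjection_apply_mem x⟩).2 ?_
  · exact h
  · refine (hE.summable_norm_sq_starProjection x).of_nonneg_of_le (fun i => by positivity)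
      fun i => ?_
    rw [norm_smul]
    change (‖c i‖ * ‖(E i).starProjection x‖) ^ 2 ≤ _
    gcongr
    exact mul_le_of_le_one_left (norm_nonneg _) (hc i)

theorem OrthogonalFamily.hasSum_starProjection [CompleteSpace H]
    (hE : OrthogonalFamily ℂ (fun i => E i) fun i => (E i).subtypeₗᵢ) {K : Submodule ℂ H}
    [CompleteSpace K] (hle : ∀ i, E i ≤ K) (hK : K ≤ (⨆ i, E i).topologicalClosure) (x : H) :
    HasSum (fun i => (E i).starProjection x) (K.starProjection x) := by
  have hs : Summable fun i => (E i).starProjection x := by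
    simpa using hE.summable_smul_starProjection (c := fun _ => 1) (by simp) x
  obtain ⟨w, hw⟩ := hs
  suffices h : K.starProjection x = w by rwa [h]
  have hKc : IsClosed (K : Set H) := (completeSpace_coe_iff_isComplete.1 inferInstance).isClosed
  refine Submodule.eq_starProjection_of_mem_orthogonal ?_ ?_
  · exact hKc.mem_of_tendsto hw (Eventually.of_forall fun S =>
      K.sum_mem fun i _ => hle i ((E i).starProjection_apply_mem x))
  -- Orthogonality to x - w is a closed condition, so it passes from the E i to the closed span.
  · have hEi : ∀ i, E i ≤ (ℂ ∙ (x - w))ᗮ := by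
      intro i y hy
      rw [Submodule.mem_orthogonal_singleton_iff_inner_left]
      have h1 : HasSum (fun j => (inner ℂ y ((E j).starProjection x) : ℂ)) (inner ℂ y w) :=
        hw.mapL (innerSL ℂ y)
      have h2 := hasSum_single (f := fun j => (inner ℂ y ((E j).starProjection x) : ℂ)) i
        fun j hj => hE (Ne.symm hj) ⟨y, hy⟩
          ⟨(E j).starProjection x, (E j).starProjection_apply_mem x⟩
      rw [inner_sub_right, h1.unique h2, ← Submodule.inner_starProjection_left_eq_right,
        Submodule.starProjection_eq_self_iff.2 hy, sub_self]
    have hcl : K ≤ (ℂ ∙ (x - w))ᗮ :=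
      hK.trans (Submodule.topologicalClosure_minimal _ (iSup_le hEi)
        (Submodule.isClosed_orthogonal _))
    rw [Submodule.mem_orthogonal]
    intro y hy
    exact (Submodule.mem_orthogonal_singleton_iff_inner_left).1 (hcl hy)

end HilbertSum

theorem tendsto_of_hasSum_of_contractions {ι E : Type*} [NormedAddCommGroup E] [NormedSpace ℂ E]
    {A : ℕ → E →L[ℂ] E} (hA : ∀ N x, ‖A N x‖ ≤ ‖x‖) {f g : ι → E} {x y : E} (hf : HasSum f x)
    (hg : HasSum g y) (hfg : ∀ i, Tendsto (fun N => A N (f i)) atTop (𝓝 (g i))) :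
    Tendsto (fun N => A N x) atTop (𝓝 y) := by
  rw [Metric.tendsto_atTop']
  intro ε hε
  have h3 : 0 < ε / 3 := by positivity
  obtain ⟨S, hS1, hS2⟩ := ((hf.eventually (Metric.ball_mem_nhds x h3)).and
    (hg.eventually (Metric.ball_mem_nhds y h3))).exists
  have h4 : Tendsto (fun N => A N (∑ i ∈ S, f i)) atTop (𝓝 (∑ i ∈ S, g i)) := by
    simp only [map_sum]
    exact tendsto_finsetSum _ fun i _ => hfg i
  obtain ⟨N₀, hN₀⟩ := Metric.tendsto_atTop'.1 h4 (ε / 3) h3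
  refine ⟨N₀, fun N hN => ?_⟩
  have h5 := hN₀ N hN
  have h6 : dist (A N x) (A N (∑ i ∈ S, f i)) ≤ dist x (∑ i ∈ S, f i) := by
    rw [dist_eq_norm, ← map_sub, dist_eq_norm]
    exact hA N _
  rw [dist_comm] at hS1
  have h7 := dist_triangle4 (A N x) (A N (∑ i ∈ S, f i)) (∑ i ∈ S, g i) y
  linarith

/-! ### Atoms of the spectral measure and the averages over the Cantor set -/

-- The product of the two twisted averages has a symbol equal to 1 at p, so μ{p} is at most the
-- squared norm of its value at z. In the limit this is ‖R Q z‖², and R Q z lies in the joint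
-- eigenspace, to which z is orthogonal.
open MeasureTheory in
theorem spectral_measure_singleton_eq_zero [CompleteSpace H] {U V : H →L[ℂ] H} (hU : U ∈ unitary (H →L[ℂ] H))
    (hV : V ∈ unitary (H →L[ℂ] H)) (hUV : Commute U V) {z : H}
    {μ : Measure (UnitAddCircle × UnitAddCircle)} [IsFiniteMeasure μ]
    (hμ : ∀ {ι : Type} (S : Finset ι) (a : ι → ℂ) (m n : ι → ℕ),
      ‖∑ i ∈ S, a i • (U ^ m i) ((V ^ n i) z)‖ ^ 2 =
        ∫ p, ‖∑ i ∈ S, a i * ((m i • p.1 + n i • p.2).toCircle : ℂ)‖ ^ 2 ∂μ)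
    {p : UnitAddCircle × UnitAddCircle} (hz : (jointEigenspace U V p).starProjection z = 0) :
    μ {p} = 0 := by
  obtain ⟨R, hR, hRU, hRin⟩ := exists_twistedAverage_limit hU p.1
  obtain ⟨Q, hQ, hQV, hQin⟩ := exists_twistedAverage_limit hV p.2
  have hRV : ∀ y, V (R y) = R (V y) := by
    intro y
    refine tendsto_nhds_unique ((V.continuous.tendsto _).comp (hR y)) ((hR (V y)).congr fun N => ?_)
    exact DFunLike.congr_fun (commute_twistedAverage hUV p.1 N).eq y
  have hmem : R (Q z) ∈ jointEigenspace U V p := by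
    rw [mem_jointEigenspace]
    refine ⟨hRU _, ?_⟩
    rw [hRV, hQV, map_smul]
  have hRQ : R (Q z) = 0 := by
    obtain ⟨h1, h2⟩ := (mem_jointEigenspace U V p _).1 hmem
    rw [← inner_self_eq_zero (𝕜 := ℂ), hRin _ _ h1, hQin _ _ h2,
      ← Submodule.starProjection_eq_self_iff.2 hmem,
      Submodule.inner_starProjection_left_eq_right, hz, inner_zero_right]
  have hle : ∀ M > 0, ∀ N > 0,
      μ.real {p} ≤ ‖twistedAverage U p.1 N (twistedAverage V p.2 M z)‖ ^ 2 := by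
    intro M hM N hN
    let a : ℕ × ℕ → ℂ := fun i => ((N : ℂ)⁻¹ * ((i.1 • -p.1).toCircle : ℂ)) *
      ((M : ℂ)⁻¹ * ((i.2 • -p.2).toCircle : ℂ))
    have h1 := hμ (Finset.range N ×ˢ Finset.range M) a Prod.fst Prod.snd
    have h2 : ∑ i ∈ Finset.range N ×ˢ Finset.range M, a i • (U ^ i.1) ((V ^ i.2) z) =
        twistedAverage U p.1 N (twistedAverage V p.2 M z) := by
      simp only [twistedAverage, smul_apply, sum_apply, map_sum, map_smul, Finset.smul_sum,
        Finset.sum_product_right, smul_smul, a]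
      refine Finset.sum_congr rfl fun i _ => Finset.sum_congr rfl fun j _ => ?_
      congr 1
      ring
    rw [h2] at h1
    rw [h1]
    set F : UnitAddCircle × UnitAddCircle → ℝ := fun q =>
      ‖∑ i ∈ Finset.range N ×ˢ Finset.range M, a i * ((i.1 • q.1 + i.2 • q.2).toCircle : ℂ)‖ ^ 2
    have hF : Continuous F := by
      have := AddCircle.continuous_toCircle (T := (1 : ℝ))
      fun_prop
    have hFint : Integrable F μ :=
      hF.integrable_of_hasCompactSupport (.of_compactSpace F)
    have hFp : F p = 1 := by
      have : ∀ i : ℕ × ℕ, a i * ((i.1 • p.1 + i.2 • p.2).toCircle : ℂ) =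
          (N : ℂ)⁻¹ * (M : ℂ)⁻¹ := by
        intro i
        have h3 : ((i.1 • -p.1).toCircle : ℂ) * ((i.2 • -p.2).toCircle : ℂ) *
            ((i.1 • p.1 + i.2 • p.2).toCircle : ℂ) = 1 := by
          rw [← Circle.coe_mul, ← Circle.coe_mul, ← AddCircle.toCircle_add,
            ← AddCircle.toCircle_add, smul_neg, smul_neg, ← neg_add, neg_add_cancel,
            AddCircle.toCircle_zero, Circle.coe_one]
        linear_combination ((N : ℂ)⁻¹ * (M : ℂ)⁻¹) * h3
      have hN' : (N : ℂ) ≠ 0 := by exact_mod_cast hN.ne'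
      have hM' : (M : ℂ) ≠ 0 := by exact_mod_cast hM.ne'
      simp only [F, this, Finset.sum_const, Finset.card_product, Finset.card_range, nsmul_eq_mul]
      push_cast
      rw [show (N : ℂ) * M * ((N : ℂ)⁻¹ * (M : ℂ)⁻¹) = 1 by field_simp]
      simp
    have h4 := setIntegral_le_integral (s := {p}) hFint (ae_of_all _ fun q => by positivity)
    rwa [integral_singleton, hFp, smul_eq_mul, mul_one] at h4
  -- An iterated limit: N first with M fixed, then M by continuity of R.
  have hle' : ∀ M > 0, μ.real {p} ≤ ‖R (twistedAverage V p.2 M z)‖ ^ 2 := fun M hM =>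
    ge_of_tendsto ((hR _).norm.pow 2) ((eventually_gt_atTop 0).mono fun N hN => hle M hM N hN)
  have hle0 : μ.real {p} ≤ ‖R (Q z)‖ ^ 2 :=
    ge_of_tendsto (((R.continuous.tendsto _).comp (hQ z)).norm.pow 2)
      ((eventually_gt_atTop 0).mono fun M hM => hle' M hM)
  rw [hRQ, norm_zero, zero_pow two_ne_zero] at hle0
  exact (measureReal_eq_zero_iff).1 (le_antisymm hle0 measureReal_nonneg)

/-- The average over the Cantor set as a bounded operator. -/
noncomputable def cantorAverageCLM (b : ℕ) (D : Finset ℕ) (U V : H →L[ℂ] H) (N : ℕ) : H →L[ℂ] H :=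
  (N : ℂ)⁻¹ • ∑ n ∈ Finset.range N,
    U ^ cantorSeq b D n * V ^ digitSum b (cantorSeq b D n)

theorem cantorAverageCLM_apply (b : ℕ) (D : Finset ℕ) (U V : H →L[ℂ] H) (N : ℕ) (x : H) :
    cantorAverageCLM b D U V N x = cantorAverage b D U V N x := by
  simp only [cantorAverageCLM, cantorAverage, smul_apply, sum_apply]
  rfl

theorem norm_cantorAverageCLM_apply_le [CompleteSpace H] (b : ℕ) (D : Finset ℕ) {U V : H →L[ℂ] H}
    (hU : U ∈ unitary (H →L[ℂ] H)) (hV : V ∈ unitary (H →L[ℂ] H)) (N : ℕ) (x : H) :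
    ‖cantorAverageCLM b D U V N x‖ ≤ ‖x‖ := by
  rw [cantorAverageCLM_apply, cantorAverage, norm_smul, norm_inv, Complex.norm_natCast]
  have h : ‖∑ n ∈ Finset.range N, (U ^ cantorSeq b D n)
      ((V ^ digitSum b (cantorSeq b D n)) x)‖ ≤ N * ‖x‖ := by
    refine (norm_sum_le_of_le _ fun n _ => le_of_eq (b := ‖x‖) ?_).trans (by simp)
    rw [norm_pow_apply_of_mem_unitary hU, norm_pow_apply_of_mem_unitary hV]
  rw [← div_eq_inv_mul]
  exact div_le_of_le_mul₀ (Nat.cast_nonneg _) (norm_nonneg _) (by rwa [mul_comm])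

theorem pow_apply_of_eigenvector {U : H →L[ℂ] H} {θ : UnitAddCircle} {y : H}
    (hy : U y = (θ.toCircle : ℂ) • y) (n : ℕ) : (U ^ n) y = ((n • θ).toCircle : ℂ) • y := by
  induction n with
  | zero => simp
  | succ n ih =>
    rw [pow_succ, mul_apply_eq_comp, hy, map_smul, ih, smul_smul, ← Circle.coe_mul,
      ← AddCircle.toCircle_add, succ_nsmul']

theorem cantorAverage_of_mem_jointEigenspace (b : ℕ) (D : Finset ℕ) {U V : H →L[ℂ] H}
    {p : UnitAddCircle × UnitAddCircle} {y : H} (hy : y ∈ jointEigenspace U V p) (N : ℕ) :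
    cantorAverage b D U V N y = cantorExpAverage b D p N • y := by
  obtain ⟨h1, h2⟩ := (mem_jointEigenspace U V p y).1 hy
  rw [cantorAverage, cantorExpAverage, mul_smul, Finset.sum_smul]
  congr 1
  refine Finset.sum_congr rfl fun n _ => ?_
  rw [pow_apply_of_eigenvector h2, map_smul, pow_apply_of_eigenvector h1, smul_smul,
    ← Circle.coe_mul, ← AddCircle.toCircle_add, add_comm]

theorem norm_cantorExpAverage_le (b : ℕ) (D : Finset ℕ) (p : UnitAddCircle × UnitAddCircle)
    (N : ℕ) : ‖cantorExpAverage b D p N‖ ≤ 1 := by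
  rw [cantorExpAverage, norm_mul, norm_inv, Complex.norm_natCast]
  refine inv_mul_le_one_of_le₀ ?_ (Nat.cast_nonneg _)
  refine (norm_sum_le_of_le _ fun n _ => (Circle.norm_coe _).le).trans ?_
  simp

open MeasureTheory in
theorem tendsto_cantorAverage_zero [CompleteSpace H] {b : ℕ} {D : Finset ℕ} {U V : H →L[ℂ] H}
    (hU : U ∈ unitary (H →L[ℂ] H)) (hV : V ∈ unitary (H →L[ℂ] H)) (hUV : Commute U V)
    {Λ : Set (UnitAddCircle × UnitAddCircle)} (hΛ : Λ.Countable)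
    (hlim : ∀ p ∉ Λ, Tendsto (fun N => cantorExpAverage b D p N) atTop (𝓝 0)) {z : H}
    (hz : ∀ p ∈ Λ, (jointEigenspace U V p).starProjection z = 0) :
    Tendsto (fun N => cantorAverage b D U V N z) atTop (𝓝 0) := by
  obtain ⟨μ, hfin, hμ⟩ := exists_joint_spectral_measure hU hV hUV z
  have hnull : μ Λ = 0 := by
    rw [← Set.biUnion_of_singleton Λ, measure_biUnion_null_iff hΛ]
    exact fun p hp => spectral_measure_singleton_eq_zero hU hV hUV hμ (hz p hp)
  have hnorm : ∀ N, ‖cantorAverage b D U V N z‖ ^ 2 =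
      ∫ p, ‖cantorExpAverage b D p N‖ ^ 2 ∂μ := by
    intro N
    have := hμ (Finset.range N) (fun _ => (N : ℂ)⁻¹) (cantorSeq b D)
      fun n => digitSum b (cantorSeq b D n)
    simp only [← Finset.smul_sum, ← Finset.mul_sum] at this
    exact this
  have hcont : ∀ N, Continuous fun p => ‖cantorExpAverage b D p N‖ ^ 2 := by
    intro N
    unfold cantorExpAverage
    have := AddCircle.continuous_toCircle (T := (1 : ℝ))
    fun_prop
  have hint : Tendsto (fun N => ∫ p, ‖cantorExpAverage b D p N‖ ^ 2 ∂μ) atTop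
      (𝓝 (∫ _, (0 : ℝ) ∂μ)) := by
    refine tendsto_integral_of_dominated_convergence (fun _ => 1)
      (fun N => (hcont N).aestronglyMeasurable) (integrable_const _) (fun N => ae_of_all _ fun p => ?_) ?_
    · rw [norm_pow, norm_norm]
      exact pow_le_one₀ (norm_nonneg _) (norm_cantorExpAverage_le b D p N)
    · have : ∀ᵐ p ∂μ, p ∉ Λ := measure_eq_zero_iff_ae_notMem.1 hnull
      filter_upwards [this] with p hp
      simpa using (hlim p hp).norm.pow 2
  rw [integral_zero] at hint
  simp only [← hnorm] at hint
  rw [tendsto_zero_iff_norm_tendsto_zero]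
  have := hint.sqrt
  simpa [Real.sqrt_sq (norm_nonneg _)] using this

end

theorem mainTheorem7
    (b : ℕ) (hb : 3 ≤ b)
    (D : Finset ℕ) (hDb : ∀ d ∈ D, d < b) (hD_two : 2 ≤ D.card) (hD_lt : D.card < b)
    (s : ℕ) (hs : IsGreatest {q : ℕ | InProgression D q} s) (hsD : ∀ d ∈ D, s ∣ d)
    {H : Type*} [NormedAddCommGroup H] [InnerProductSpace ℂ H] [CompleteSpace H]
    (U V : H →L[ℂ] H) (hU : U ∈ unitary (H →L[ℂ] H)) (hV : V ∈ unitary (H →L[ℂ] H))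
    (hUV : Commute U V) :
    ∃ L : H → H,
      (∀ x : H, Tendsto (fun N : ℕ => cantorAverage b D U V N x) atTop (𝓝 (L x))) ∧
      (∀ x : H,
        L x = L ((pointSpectralSubspace U V (resonantPoints b s)).starProjection x)) ∧
      ∃ c : UnitAddCircle × UnitAddCircle → ℂ,
        (∀ p, Tendsto (fun N : ℕ => cantorExpAverage b D p N) atTop (𝓝 (c p))) ∧
        ∀ x : H, HasSum
          (fun p : resonantPoints b s =>
            c p.1 • (jointEigenspace U V p.1).starProjection x) (L x) := by
  set Λ := resonantPoints b s
  set K := pointSpectralSubspace U V Λ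
  choose c hc hc0 using exists_tendsto_cantorExpAverage (show 2 ≤ b by omega) hDb hD_two hs hsD
  -- Step size 1 is always admissible.
  have hs0 : 0 < s := hs.2 ⟨0, fun d _ => ⟨d, by simp⟩⟩
  have hc1 : ∀ p, ‖c p‖ ≤ 1 := fun p =>
    le_of_tendsto' (hc p).norm fun N => norm_cantorExpAverage_le b D p N
  have hE : OrthogonalFamily ℂ (fun p : Λ => jointEigenspace U V p.1)
      fun p => (jointEigenspace U V p.1).subtypeₗᵢ :=
    (orthogonalFamily_jointEigenspace hU hV).comp Subtype.val_injective
  have hsup : ⨆ p : Λ, jointEigenspace U V p.1 = ⨆ p ∈ Λ, jointEigenspace U V p := iSup_subtype'' _ _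
  have hEK : ∀ p : Λ, jointEigenspace U V p.1 ≤ K := fun p =>
    (le_iSup₂ (f := fun p (_ : p ∈ Λ) => jointEigenspace U V p) p.1 p.2).trans
      (Submodule.le_topologicalClosure _)
  have hP : ∀ x, HasSum (fun p : Λ => (jointEigenspace U V p.1).starProjection x)
      (K.starProjection x) :=
    hE.hasSum_starProjection hEK (by rw [hsup]; exact le_rfl)
  have hsum : ∀ x, HasSum (fun p : Λ => c p.1 • (jointEigenspace U V p.1).starProjection x)
      (∑' p : Λ, c p.1 • (jointEigenspace U V p.1).starProjection x) := fun x =>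
    (hE.summable_smul_starProjection (fun p : Λ => hc1 p.1) x).hasSum
  set L : H → H := fun x => ∑' p : Λ, c p.1 • (jointEigenspace U V p.1).starProjection x
  have hLP : ∀ x, Tendsto (fun N => cantorAverage b D U V N (K.starProjection x)) atTop
      (𝓝 (L x)) := by
    intro x
    simp only [← cantorAverageCLM_apply]
    refine tendsto_of_hasSum_of_contractions (norm_cantorAverageCLM_apply_le b D hU hV) (hP x)
      (hsum x) fun p => ?_
    simp only [cantorAverageCLM_apply, cantorAverage_of_mem_jointEigenspace b D
      ((jointEigenspace U V p.1).starProjection_apply_mem x)]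
    exact (hc p.1).smul_const _
  have hL : ∀ x, Tendsto (fun N => cantorAverage b D U V N x) atTop (𝓝 (L x)) := by
    intro x
    -- The residual is orthogonal to K, hence to every joint eigenspace over Λ.
    have h0 : Tendsto (fun N => cantorAverage b D U V N (x - K.starProjection x)) atTop (𝓝 0) := by
      refine tendsto_cantorAverage_zero hU hV hUV (countable_resonantPoints b hs0)
        (fun p hp => hc0 p hp ▸ hc p) fun p hp => ?_
      refine (Submodule.starProjection_apply_eq_zero_iff _).2 ?_
      exact Submodule.orthogonal_le (hEK ⟨p, hp⟩) (K.sub_starProjection_mem_orthogonal x)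
    have h1 := (hLP x).add h0
    rw [add_zero] at h1
    refine h1.congr fun N => ?_
    simp only [← cantorAverageCLM_apply]
    rw [← map_add, add_sub_cancel]
  exact ⟨L, hL, fun x => tendsto_nhds_unique (hLP x) (hL _), c, hc, hsum⟩
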